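/- **Setting.** Let $\mathbb H^2=\{(x_1,x_2):x_2>0\}$ be the half-plane model of the hyperbolic plane, with metric $g=(dx_1^2+dx_2^2)/x_2^2$, distance $d_g$, measure $d\mu=x_2^{-2}dx_1dx_2$, base point $\mathrm O=(0,1)$, and $\mathrm L^2(\mathbb H^2)=\mathrm L^2(\mathbb H^2,\mu;\mathbb R)$. Let $\Delta_g=x_2^2(\partial_{x_1}^2+\partial_{x_2}^2)$ be the Laplace–Beltrami operator, as a self-adjoint operator on $\mathrm L^2(\mathbb H^2)$ with domain $\{v\in \mathrm L^2:\Delta_g v\in \mathrm L^2\}$ ($\Delta_g v$ in the sense of distributions). Let $\mathcal M$ be the space of $v\in C^6(\mathbb H^2)$ such that for every $w>0$ $$\|v\|_{\mathcal M,w}:=\sum_{\alpha=0}^6\big\|e^{w\,d_g(\mathrm O,\cdot)}|\nabla_g^\alpha v|_g\big\|_{\mathrm L^2(\mathbb H^2)}<\infty ,$$ where $\nabla_g^\alpha$ is the $\alpha$-fold covariant derivative, with the topology given by these norms. For $T>0$, $u_0\in\mathcal M$ and $f\in C([0,T],\mathcal M)$ let $u$ be the solution in $\mathrm L^2(\mathbb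 H^2)$ of $$\partial_t u=\Delta_g u+f\ \text{ on }(0,T],\qquad u(0)=u_0. \tag{1}$$ **Discrete objects.** For each $h>0$ let $(\mathcal C_h^{p})_{p\in Z_1\times Z_2}$, with $Z_1,Z_2\subseteq\mathbb Z$ possibly depending on $h$, be the cells of a grid on $\mathbb H^2$ (measurable sets of positive finite area $|\mathcal C_h^p|_g=\mu(\mathcal C_h^p)$). Let $\ell_h^2$ be the Hilbert space of real grid functions with scalar product $\langle a,b\rangle_{\ell^2_h}=\sum_p|\mathcal C_h^p|_g\,a_pb_p$, let $(\Pi_hv)_p=|\mathcal C_h^p|_g^{-1}\int_{\mathcal C_h^p}v\,d\mu$, and let $\Delta_h$ be a linear operator on $\ell^2_h$ with domain $D(\Delta_h)\subseteq\ell^2_h$ (an abstract discrete Laplacian). Assume that there is $h_0>0$ such that: * (L1) for all $h\in(0,h_0)$ and $v\in \mathrm L^2(\mathbb H^2)$: $\Pi_hv\in\ell_h^2$ and $\|\Pi_hv\|_{\ell_h^2}\le\|v\|_{\mathrm L^2(\mathbb H^2)}$; * (L2) for all $h\in(0,h_0)$, $\Delta_h$ is self-adjoint (in particular densely defined) and m-dissipative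 on $\ell^2_h$, i.e. $\|a\|\le\|a-\lambda\Delta_ha\|$ for all $a\in D(\Delta_h)$, $\lambda>0$, and $\mathrm{id}-\lambda\Delta_h:D(\Delta_h)\to\ell^2_h$ is onto for all $\lambda>0$; * (L3) for all $T>0$, $u_0\in\mathcal M$ and $f\in C([0,T],\mathcal M)$ there is a constant $C_{u_0,f,T}>0$ such that the solution $u$ of (1) satisfies $\Pi_hu(t)\in D(\Delta_h)$ and $$\|\Delta_h\Pi_hu(t)-\Pi_h\Delta_gu(t)\|_{\ell_h^2}\le C_{u_0,f,T}\,h^2\qquad\text{for all }h\in(0,h_0),\ t\in[0,T].$$ **Theorem (convergence of the FDM scheme).** For all $T>0$, $u_0\in\mathcal M$ and $f\in C([0,T],\mathcal M)$ there is a constant $C_{u_0,f,T}>0$ such that for every $h\in(0,h_0)$ and $t\in[0,T]$ $$\|u^h(t)-\Pi_hu(t)\|_{\ell_h^2}\le C_{u_0,f,T}\,h^2 ,$$ where $u$ is the solution of (1) and $u^h\in C([0,T],\ell_h^2)$ is the (mild) solution of the semi-discrete problem $\partial_tu^h=\Delta_hu^h+\Pi_hf$ on $(0,T]$, $u^h(0)=\Pi_hu_0$.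 -/

import Mathlib

open MeasureTheory Filter Topology UpperHalfPlane
open scoped ENNReal

noncomputable section

namespace FDM

/-! ### The hyperbolic plane

The half-plane model is Mathlib's `ℍ`: `dist` is the hyperbolic distance and `volume` is the
hyperbolic measure `dx₁ dx₂ / x₂ ^ 2`. The coordinates are `x₁ = re z` and `x₂ = im z`, and the
base point `O = (0, 1)` is `UpperHalfPlane.I`. -/

/-- The real Hilbert space of square-integrable functions on the hyperbolic plane. -/
abbrev HypL2 : Type := Lp ℝ 2 (volume : Measure ℍ)

open Classical in
/-- The class in `L²(ν)` of a square-integrable function (and `0` for any other function). -/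
def toL2 {α : Type*} [MeasurableSpace α] (ν : Measure α) (v : α → ℝ) : Lp ℝ 2 ν :=
  if hv : MemLp v 2 ν then hv.toLp v else 0

/-- `v` is of class `C^n` on the hyperbolic plane; as `n : ℕ∞`, `n = ⊤` means smooth. -/
def IsCn (n : ℕ∞) (v : ℍ → ℝ) : Prop :=
  ContDiffOn ℝ n (v ∘ ofComplex) {z : ℂ | 0 < z.im}

/-- The coordinate directions: `0` is `x₁`, `1` is `x₂`. -/
def dir (k : Fin 2) : ℂ := if k = 0 then 1 else Complex.I

/-- The partial derivative with respect to the `k`-th coordinate. -/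
def pderiv (k : Fin 2) (v : ℍ → ℝ) (z : ℍ) : ℝ :=
  fderiv ℝ (v ∘ ofComplex) (z : ℂ) (dir k)

/-- The Laplace–Beltrami operator `x₂ ^ 2 (∂₁² + ∂₂²)` on smooth functions. -/
def laplacian (v : ℍ → ℝ) (z : ℍ) : ℝ :=
  z.im ^ 2 * (pderiv 0 (pderiv 0 v) z + pderiv 1 (pderiv 1 v) z)

/-- The Christoffel symbols `Γ^m_{k i}` of the metric `(dx₁² + dx₂²) / x₂²`:
`Γ^0_{01} = Γ^0_{10} = Γ^1_{11} = -1 / x₂`, `Γ^1_{00} = 1 / x₂`, the others vanish. -/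
def christoffel (k i m : Fin 2) (z : ℍ) : ℝ :=
  if m = 0 then (if k = i then 0 else -(1 / z.im))
  else (if k = i then (if k = 0 then 1 / z.im else -(1 / z.im)) else 0)

/-- The covariant derivative of a `(0, n)`-tensor field, given by its components in the
coordinates:
`(∇T)_{k i₁ … iₙ} = ∂ₖ T_{i₁ … iₙ} - ∑ₛ ∑ₘ Γ^m_{k iₛ} T_{i₁ … m … iₙ}`. -/
def covDeriv {n : ℕ} (S : (Fin n → Fin 2) → ℍ → ℝ) : (Fin (n + 1) → Fin 2) → ℍ → ℝ :=
  fun J z => pderiv (J 0) (S (Fin.tail J)) z -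
    ∑ s : Fin n, ∑ m : Fin 2,
      christoffel (J 0) (Fin.tail J s) m z * S (Function.update (Fin.tail J) s m) z

/-- The components of the `n`-fold covariant derivative `∇_g^n v`. -/
def iterCovDeriv (v : ℍ → ℝ) : (n : ℕ) → (Fin n → Fin 2) → ℍ → ℝ
  | 0 => fun _ => v
  | n + 1 => covDeriv (iterCovDeriv v n)

/-- The pointwise norm `|S|_g` of a `(0, n)`-tensor field; the inverse metric is `x₂ ^ 2` times
the identity matrix. -/
def tensorNorm {n : ℕ} (S : (Fin n → Fin 2) → ℍ → ℝ) (z : ℍ) : ℝ :=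
  Real.sqrt (z.im ^ (2 * n) * ∑ J : Fin n → Fin 2, S J z ^ 2)

/-- The weighted norm `∑_{α ≤ 6} ‖e^{w d(O, x)} |∇_g^α v|_g‖_{L²}`, with values in `[0, ∞]`. -/
def weightedNorm (w : ℝ) (v : ℍ → ℝ) : ℝ≥0∞ :=
  ∑ α ∈ Finset.range 7,
    eLpNorm (fun z : ℍ =>
      Real.exp (w * dist UpperHalfPlane.I z) * tensorNorm (iterCovDeriv v α) z) 2 volume

/-- The space `𝓜` of `C⁶` functions all of whose exponentially weighted norms are finite. -/
def MemM (v : ℍ → ℝ) : Prop :=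
  IsCn 6 v ∧ ∀ w : ℝ, 0 < w → weightedNorm w v < ∞

/-- The assumption on the data: `u₀ ∈ 𝓜` and `f ∈ C([0, T], 𝓜)`. -/
structure AdmissibleData (T : ℝ) (u₀ : ℍ → ℝ) (f : ℝ → ℍ → ℝ) : Prop where
  initial : MemM u₀
  source : ∀ t ∈ Set.Icc 0 T, MemM (f t)
  source_continuous : ∀ w : ℝ, 0 < w → ∀ t ∈ Set.Icc 0 T,
    Tendsto (fun s => weightedNorm w (f s - f t)) (𝓝[Set.Icc 0 T] t) (𝓝 0)

/-- `v ∈ D(Δ_g)` and `Δ_g v = w`, where `Δ_g` is the Laplace–Beltrami operator as an unbounded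
operator on `L²`: its domain consists of the `v ∈ L²` whose distributional Laplacian is in `L²`.
(Since the hyperbolic plane is complete, this is the self-adjoint realisation of `Δ_g`.) -/
def HasLaplacian (v w : HypL2) : Prop :=
  ∀ φ : ℍ → ℝ, IsCn ⊤ φ → HasCompactSupport φ →
    ∫ z, v z * laplacian φ z = ∫ z, w z * φ z

/-- `u : [0, T] → L²` is a solution of the heat equation
`∂ₜ u = Δ_g u + f` on `(0, T]`, `u(0) = u₀`. -/
structure IsHeatSolution (T : ℝ) (u₀ : ℍ → ℝ) (f : ℝ → ℍ → ℝ) (u : ℝ → HypL2) : Prop where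
  continuousOn : ContinuousOn u (Set.Icc 0 T)
  initial : u 0 = toL2 volume u₀
  equation : ∀ t ∈ Set.Ioc 0 T, ∃ w : HypL2, HasLaplacian (u t) w ∧
    HasDerivWithinAt u (w + toL2 volume (f t)) (Set.Icc 0 T) t

/-! ### Numerical grids -/

/-- A numerical grid on the hyperbolic plane: measurable cells of positive finite hyperbolic area
indexed by `Z₁ × Z₂` with `Z₁, Z₂ ⊆ ℤ`. -/
structure Grid where
  Z₁ : Set ℤ
  Z₂ : Set ℤ
  cell : Z₁ × Z₂ → Set ℍ
  measurableSet_cell : ∀ p, MeasurableSet (cell p)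
  area_ne_zero : ∀ p, volume (cell p) ≠ 0
  area_ne_top : ∀ p, volume (cell p) ≠ ∞

namespace Grid

variable (G : Grid)

/-- The measure on the index set giving to each index the hyperbolic area of its cell. -/
def weight : Measure (G.Z₁ × G.Z₂) :=
  Measure.sum fun p => volume (G.cell p) • Measure.dirac p

/-- The Hilbert space `ℓ²_h` of grid functions, with scalar product
`⟨u, v⟩ = ∑ₚ |C_p| u_p v_p`. -/
abbrev GridL2 : Type := Lp ℝ 2 G.weight

/-- The mean values of a function over the cells. -/
def cellMean (v : HypL2) (p : G.Z₁ × G.Z₂) : ℝ :=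
  (volume.real (G.cell p))⁻¹ * ∫ z in G.cell p, v z

/-- The projection `Π_h : L² → ℓ²_h`, `(Π_h v)_p = |C_p|⁻¹ ∫_{C_p} v dμ` (used only when all
`Π_h v` belong to `ℓ²_h`). -/
def proj (v : HypL2) : G.GridL2 := toL2 G.weight (G.cellMean v)

/-- (L1) The projection maps `L²` into `ℓ²_h` and is a contraction. -/
def ContractiveProj : Prop :=
  ∀ v : HypL2, MemLp (G.cellMean v) 2 G.weight ∧ ‖G.proj v‖ ≤ ‖v‖

end Grid

/-- m-dissipativity of an unbounded operator `A`: it is dissipative, that is,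
`‖x‖ ≤ ‖x - l A x‖` for `x ∈ D(A)` and `l > 0`, and `x - l A x = y` is solvable for all `l > 0`
and all `y`. -/
structure IsMDissipative {H : Type*} [NormedAddCommGroup H] [InnerProductSpace ℝ H]
    (A : H →ₗ.[ℝ] H) : Prop where
  dissipative : ∀ l : ℝ, 0 < l → ∀ x : A.domain, ‖(x : H)‖ ≤ ‖(x : H) - l • A x‖
  surjective : ∀ l : ℝ, 0 < l → ∀ y : H, ∃ x : A.domain, (x : H) - l • A x = y

/-- `y : [0, T] → H` is the (mild) solution of `y' = A y + g`, `y(0) = x`: it is continuous, and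
for all `t ∈ [0, T]` the integral `∫₀ᵗ y` is in `D(A)` and
`y(t) = x + A ∫₀ᵗ y(s) ds + ∫₀ᵗ g(s) ds`.
For m-dissipative self-adjoint `A` this is equivalent to Duhamel's formula
`y(t) = e^{tA} x + ∫₀ᵗ e^{(t-s)A} g(s) ds`, and every classical solution is of this kind. -/
structure IsSolution {H : Type*} [NormedAddCommGroup H] [InnerProductSpace ℝ H]
    (A : H →ₗ.[ℝ] H) (T : ℝ) (x : H) (g : ℝ → H) (y : ℝ → H) : Prop where
  continuousOn : ContinuousOn y (Set.Icc 0 T)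
  equation : ∀ t ∈ Set.Icc 0 T,
    (∫ s in (0 : ℝ)..t, y s, y t - x - ∫ s in (0 : ℝ)..t, g s) ∈ A.graph

/-- `uh` is the solution of the semi-discrete problem
`∂ₜ uh = Δ_h uh + Π_h f` on `(0, T]`, `uh(0) = Π_h u₀`. -/
def IsSemidiscreteSolution (G : Grid) (L : G.GridL2 →ₗ.[ℝ] G.GridL2) (T : ℝ) (u₀ : ℍ → ℝ)
    (f : ℝ → ℍ → ℝ) (uh : ℝ → G.GridL2) : Prop :=
  IsSolution L T (G.proj (toL2 volume u₀)) (fun t => G.proj (toL2 volume (f t))) uh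

/-- (L3) Consistency of order `h²` along the solutions `u` of the heat equation:
`Π_h u(t) ∈ D(Δ_h)` and `‖Δ_h Π_h u(t) - Π_h Δ_g u(t)‖ ≤ C h²` for `h ∈ (0, h₀)`, `t ∈ [0, T]`,
with `C` depending only on the data `u₀`, `f`, `T` (and on the family of discrete operators). -/
def Consistent (G : ℝ → Grid) (L : (h : ℝ) → (G h).GridL2 →ₗ.[ℝ] (G h).GridL2) (h₀ : ℝ) : Prop :=
  ∀ (T : ℝ) (u₀ : ℍ → ℝ) (f : ℝ → ℍ → ℝ), 0 < T → AdmissibleData T u₀ f →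
    ∃ C : ℝ, 0 < C ∧ ∀ u : ℝ → HypL2, IsHeatSolution T u₀ f u →
      ∀ h ∈ Set.Ioo 0 h₀, ∀ t ∈ Set.Icc 0 T, ∀ w : HypL2, HasLaplacian (u t) w →
        ∃ hu : (G h).proj (u t) ∈ (L h).domain,
          ‖L h ⟨(G h).proj (u t), hu⟩ - (G h).proj w‖ ≤ C * h ^ 2

end FDM

end

/-!
The error `e = uʰ - Πₕ u` solves, in the mild sense, `e' = Δₕ e + r`, where
`r = Δₕ Πₕ u - Πₕ Δ_g u` is of size `C h²` by consistency. Formally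
`½ d/dt ‖e‖² = ⟪e, Δₕ e⟫ + ⟪e, r⟫ ≤ C h² ‖e‖`, because a dissipative operator satisfies
`⟪x, A x⟫ ≤ 0`, and hence `‖e(t)‖ ≤ C h² t`. A mild solution need be neither differentiable nor
`D(Δₕ)`-valued, so this estimate is made for `J e`, where `J = (id - l Δₕ)⁻¹` is a resolvent: `J`
is a contraction that turns `Δₕ` into a bounded operator. Letting `l → 0` recovers `e`.
-/

noncomputable section

namespace FDM

open scoped InnerProductSpace

section Calculus

theorem hasDerivAt_integral_of_continuousOn_Icc {E : Type*} [NormedAddCommGroup E]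
    [NormedSpace ℝ E] [CompleteSpace E] {g : ℝ → E} {a b t : ℝ}
    (hg : ContinuousOn g (Set.Icc a b)) (ht : t ∈ Set.Ioo a b) :
    HasDerivAt (fun r => ∫ s in a..r, g s) (g t) t :=
  intervalIntegral.integral_hasDerivAt_right
    ((hg.mono (Set.Icc_subset_Icc_right ht.2.le)).intervalIntegrable_of_Icc ht.1.le)
    ((hg.mono Set.Ioo_subset_Icc_self).stronglyMeasurableAtFilter isOpen_Ioo t ht)
    (hg.continuousAt (Icc_mem_nhds ht.1 ht.2))

variable {H : Type*} [NormedAddCommGroup H] [InnerProductSpace ℝ H]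
  {z z' : ℝ → H} {a b K : ℝ}

theorem antitoneOn_sqrt_norm_sq_add_sub_mul (hK : 0 ≤ K) (hz : ContinuousOn z (Set.Icc a b))
    (hderiv : ∀ t ∈ Set.Ioo a b, HasDerivAt z (z' t) t)
    (hinner : ∀ t ∈ Set.Ioo a b, ⟪z t, z' t⟫_ℝ ≤ K * ‖z t‖) {δ : ℝ} (hδ : 0 < δ) :
    AntitoneOn (fun t => √(‖z t‖ ^ 2 + δ ^ 2) - K * t) (Set.Icc a b) := by
  have hpos : ∀ t, 0 < ‖z t‖ ^ 2 + δ ^ 2 := fun t => by positivity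
  refine antitoneOn_of_hasDerivWithinAt_nonpos (convex_Icc a b)
    (f' := fun t => 2 * ⟪z t, z' t⟫_ℝ / (2 * √(‖z t‖ ^ 2 + δ ^ 2)) - K * 1)
    (by fun_prop) ?_ ?_
  all_goals rw [interior_Icc]; intro t ht
  · exact ((((hderiv t ht).norm_sq.add_const _).sqrt (hpos t).ne').sub
      ((hasDerivAt_id t).const_mul K)).hasDerivWithinAt
  · rw [mul_div_mul_left _ _ two_ne_zero, mul_one, sub_nonpos,
      div_le_iff₀ (Real.sqrt_pos.mpr (hpos t))]
    calc ⟪z t, z' t⟫_ℝ ≤ K * ‖z t‖ := hinner t ht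
      _ ≤ K * √(‖z t‖ ^ 2 + δ ^ 2) := by
        gcongr
        exact Real.le_sqrt_of_sq_le (le_add_of_nonneg_right (sq_nonneg δ))

theorem norm_le_add_mul_of_inner_deriv_le (hK : 0 ≤ K) (hz : ContinuousOn z (Set.Icc a b))
    (hderiv : ∀ t ∈ Set.Ioo a b, HasDerivAt z (z' t) t)
    (hinner : ∀ t ∈ Set.Ioo a b, ⟪z t, z' t⟫_ℝ ≤ K * ‖z t‖) {t : ℝ} (ht : t ∈ Set.Icc a b) :
    ‖z t‖ ≤ ‖z a‖ + K * (t - a) := by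
  -- `‖z‖` need not be differentiable where `z` vanishes, hence the regularization by `δ`.
  refine le_of_forall_pos_le_add fun δ hδ => ?_
  have hanti := antitoneOn_sqrt_norm_sq_add_sub_mul hK hz hderiv hinner hδ
    (Set.left_mem_Icc.mpr (ht.1.trans ht.2)) ht ht.1
  have hlower : ‖z t‖ ≤ √(‖z t‖ ^ 2 + δ ^ 2) :=
    Real.le_sqrt_of_sq_le (le_add_of_nonneg_right (sq_nonneg δ))
  have hupper : √(‖z a‖ ^ 2 + δ ^ 2) ≤ ‖z a‖ + δ :=
    Real.sqrt_le_iff.mpr ⟨by positivity, by nlinarith [norm_nonneg (z a)]⟩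
  linarith

end Calculus

namespace IsMDissipative

variable {H : Type*} [NormedAddCommGroup H] [InnerProductSpace ℝ H] {A : H →ₗ.[ℝ] H}

theorem inner_map_self_nonpos (hA : IsMDissipative A) (x : A.domain) :
    ⟪(x : H), A x⟫_ℝ ≤ 0 := by
  have hle : ∀ l : ℝ, 0 < l → 2 * ⟪(x : H), A x⟫_ℝ ≤ l * ‖A x‖ ^ 2 := fun l hl => by
    have hsq := pow_le_pow_left₀ (norm_nonneg _) (hA.dissipative l hl x) 2
    rw [norm_sub_sq_real, inner_smul_right, norm_smul, Real.norm_of_nonneg hl.le] at hsq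
    exact le_of_mul_le_mul_left (by linarith) hl
  have hlim : Tendsto (fun l : ℝ => l * ‖A x‖ ^ 2) (𝓝[>] 0) (𝓝 0) :=
    ((continuous_mul_const (‖A x‖ ^ 2)).tendsto' 0 0 (zero_mul _)).mono_left nhdsWithin_le_nhds
  linarith [ge_of_tendsto hlim (eventually_nhdsWithin_of_forall hle)]

theorem dense_domain [CompleteSpace H] (hA : IsMDissipative A) :
    Dense (A.domain : Set H) := by
  rw [Submodule.dense_iff_topologicalClosure_eq_top, Submodule.topologicalClosure_eq_top_iff,
    Submodule.eq_bot_iff]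
  intro y hy
  obtain ⟨x, hx⟩ := hA.surjective 1 one_pos y
  rw [one_smul] at hx
  -- `0 = ⟪x, y⟫ = ‖x‖² - ⟪x, A x⟫ ≥ ‖x‖²`
  have horth : ⟪(x : H), (x : H) - A x⟫_ℝ = 0 := by
    rw [hx]; exact A.domain.inner_right_of_mem_orthogonal x.2 hy
  rw [inner_sub_right, real_inner_self_eq_norm_sq] at horth
  have hsq : ‖(x : H)‖ ^ 2 = 0 :=
    le_antisymm (by linarith only [horth, hA.inner_map_self_nonpos x]) (sq_nonneg _)
  have hx₀ : x = 0 := Subtype.ext (norm_eq_zero.mp (sq_eq_zero_iff.mp hsq))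
  rw [← hx, hx₀, LinearPMap.map_zero, Submodule.coe_zero, sub_zero]

/-- The linear isomorphism `id - l A : D(A) ≃ H`, defined to obtain the resolvent as its
inverse. -/
def idSubSMulEquiv (hA : IsMDissipative A) {l : ℝ} (hl : 0 < l) : A.domain ≃ₗ[ℝ] H :=
  LinearEquiv.ofBijective (A.domain.subtype - l • A.toFun) <| by
    refine ⟨(injective_iff_map_eq_zero _).mpr fun x hx => ?_, hA.surjective l hl⟩
    have hdiss : ‖(x : H)‖ ≤ ‖(A.domain.subtype - l • A.toFun) x‖ := hA.dissipative l hl x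
    rw [hx, norm_zero] at hdiss
    exact Subtype.ext (norm_le_zero_iff.mp hdiss)

/-- The resolvent `(id - l A)⁻¹` as a bounded operator on `H`. -/
def resolvent (hA : IsMDissipative A) {l : ℝ} (hl : 0 < l) : H →L[ℝ] H :=
  (A.domain.subtype ∘ₗ (hA.idSubSMulEquiv hl).symm.toLinearMap).mkContinuous 1 fun y => by
    have hdiss := hA.dissipative l hl ((hA.idSubSMulEquiv hl).symm y)
    rw [one_mul]
    exact hdiss.trans_eq (congrArg norm ((hA.idSubSMulEquiv hl).apply_symm_apply y))

/-- The Yosida approximation `l⁻¹ ((id - l A)⁻¹ - id)` of `A`, a bounded operator on `H`. -/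
def yosida (hA : IsMDissipative A) {l : ℝ} (hl : 0 < l) : H →L[ℝ] H :=
  l⁻¹ • (hA.resolvent hl - ContinuousLinearMap.id ℝ H)

variable {l : ℝ} (hA : IsMDissipative A) (hl : 0 < l)

theorem norm_resolvent_apply_le (y : H) : ‖hA.resolvent hl y‖ ≤ ‖y‖ :=
  (ContinuousLinearMap.le_of_opNorm_le _ (LinearMap.mkContinuous_norm_le _ zero_le_one _)
    y).trans_eq (one_mul _)

theorem resolvent_mem_domain (y : H) : hA.resolvent hl y ∈ A.domain :=
  ((hA.idSubSMulEquiv hl).symm y).2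

theorem resolvent_sub_smul_map_resolvent (y : H) :
    hA.resolvent hl y - l • A ⟨hA.resolvent hl y, hA.resolvent_mem_domain hl y⟩ = y :=
  (hA.idSubSMulEquiv hl).apply_symm_apply y

theorem resolvent_sub_smul_map (x : A.domain) : hA.resolvent hl (x - l • A x) = x :=
  congrArg Subtype.val ((hA.idSubSMulEquiv hl).symm_apply_apply x)

theorem smul_yosida_apply (y : H) : l • hA.yosida hl y = hA.resolvent hl y - y :=
  smul_inv_smul₀ hl.ne' _

theorem map_resolvent (y : H) :
    A ⟨hA.resolvent hl y, hA.resolvent_mem_domain hl y⟩ = hA.yosida hl y := by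
  refine (smul_right_inj hl.ne').mp ?_
  rw [smul_yosida_apply, eq_sub_iff_add_eq, ← eq_sub_iff_add_eq',
    resolvent_sub_smul_map_resolvent]

theorem resolvent_map (x : A.domain) : hA.resolvent hl (A x) = hA.yosida hl x := by
  refine (smul_right_inj hl.ne').mp ?_
  rw [smul_yosida_apply, eq_sub_iff_add_eq, ← eq_sub_iff_add_eq', ← map_smul, ← map_sub,
    resolvent_sub_smul_map]

theorem inner_resolvent_yosida_nonpos (y : H) :
    ⟪hA.resolvent hl y, hA.yosida hl y⟫_ℝ ≤ 0 := by
  rw [← map_resolvent]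
  exact hA.inner_map_self_nonpos ⟨_, hA.resolvent_mem_domain hl y⟩

theorem norm_resolvent_sub_self_le (x : A.domain) :
    ‖hA.resolvent hl (x : H) - x‖ ≤ l * ‖A x‖ := by
  rw [← smul_yosida_apply, ← resolvent_map, norm_smul, Real.norm_of_nonneg hl.le]
  exact mul_le_mul_of_nonneg_left (hA.norm_resolvent_apply_le hl _) hl.le

theorem tendsto_resolvent [CompleteSpace H] (y : H) :
    Tendsto (fun l : Set.Ioi (0 : ℝ) => hA.resolvent l.2 y) atBot (𝓝 y) := by
  have hequi : Equicontinuous fun (l : Set.Ioi (0 : ℝ)) => ⇑(hA.resolvent l.2) :=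
    (LipschitzWith.uniformEquicontinuous _ 1 fun l =>
      AddMonoidHomClass.lipschitz_of_bound_nnnorm _ 1 fun z =>
        (hA.norm_resolvent_apply_le l.2 z).trans_eq (one_mul _).symm).equicontinuous
  refine (hequi y).tendsto_of_mem_closure (f := id) (s := A.domain)
    (tendsto_id.mono_left nhdsWithin_le_nhds) (fun x hx => ?_) (hA.dense_domain y)
  have hlim : Tendsto (fun l : ℝ => l * ‖A ⟨x, hx⟩‖) (𝓝[>] 0) (𝓝 0) :=
    ((continuous_mul_const ‖A ⟨x, hx⟩‖).tendsto' 0 0 (zero_mul _)).mono_left nhdsWithin_le_nhds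
  rw [tendsto_iff_norm_sub_tendsto_zero]
  exact squeeze_zero (fun _ => norm_nonneg _)
    (fun l => hA.norm_resolvent_sub_self_le l.2 ⟨x, hx⟩)
    ((tendsto_comp_coe_Ioi_atBot).mpr hlim)

end IsMDissipative

section Stability

variable {H : Type*} [NormedAddCommGroup H] [InnerProductSpace ℝ H] {A : H →ₗ.[ℝ] H}
  {T K : ℝ} {x : H} {g y v : ℝ → H}

/-- `v` is a strong approximate solution of `v' = A v + g` on `(0, T)`, whose defect
`A v + g - v'` has norm at most `K`. -/
structure IsApproxSolution (A : H →ₗ.[ℝ] H) (T K : ℝ) (g v : ℝ → H) : Prop where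
  continuousOn : ContinuousOn v (Set.Icc 0 T)
  defect_le : ∀ t ∈ Set.Ioo 0 T, ∃ (hv : v t ∈ A.domain) (v' : H),
    HasDerivAt v v' t ∧ ‖A ⟨v t, hv⟩ + g t - v'‖ ≤ K

theorem IsSolution.apply_zero (hy : IsSolution A T x g y) (hT : 0 ≤ T) : y 0 = x := by
  have hgraph := hy.equation 0 (Set.left_mem_Icc.mpr hT)
  simp only [intervalIntegral.integral_same, sub_zero] at hgraph
  exact sub_eq_zero.mp (A.graph_fst_eq_zero_snd hgraph rfl)

theorem IsSolution.resolvent_apply (hy : IsSolution A T x g y) (hA : IsMDissipative A) {l : ℝ}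
    (hl : 0 < l) {t : ℝ} (ht : t ∈ Set.Icc 0 T) :
    hA.resolvent hl (y t) = hA.yosida hl (∫ s in (0 : ℝ)..t, y s) + hA.resolvent hl x +
      hA.resolvent hl (∫ s in (0 : ℝ)..t, g s) := by
  obtain ⟨Y, hY, hAY⟩ := (LinearPMap.mem_graph_iff A).mp (hy.equation t ht)
  simp only at hY hAY
  rw [← hY, ← hA.resolvent_map, hAY, ← map_add, ← map_add]
  congr 1
  abel

theorem IsSolution.hasDerivAt_resolvent [CompleteSpace H] (hy : IsSolution A T x g y)
    (hA : IsMDissipative A) (hg : ContinuousOn g (Set.Icc 0 T)) {l : ℝ} (hl : 0 < l) {t : ℝ}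
    (ht : t ∈ Set.Ioo 0 T) :
    HasDerivAt (fun s => hA.resolvent hl (y s))
      (hA.yosida hl (y t) + hA.resolvent hl (g t)) t := by
  have hint_y := hasDerivAt_integral_of_continuousOn_Icc hy.continuousOn ht
  have hint_g := hasDerivAt_integral_of_continuousOn_Icc hg ht
  refine ((((hA.yosida hl).hasFDerivAt.comp_hasDerivAt t hint_y).add_const
    (hA.resolvent hl x)).add
      ((hA.resolvent hl).hasFDerivAt.comp_hasDerivAt t hint_g)).congr_of_eventuallyEq ?_
  filter_upwards [Icc_mem_nhds ht.1 ht.2] with s hs using hy.resolvent_apply hA hl hs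

theorem IsSolution.norm_resolvent_sub_le [CompleteSpace H] (hy : IsSolution A T x g y)
    (hA : IsMDissipative A) (hg : ContinuousOn g (Set.Icc 0 T))
    (hv : IsApproxSolution A T K g v) (hK : 0 ≤ K) {l : ℝ} (hl : 0 < l) {t : ℝ}
    (ht : t ∈ Set.Icc 0 T) :
    ‖hA.resolvent hl (y t - v t)‖ ≤ ‖x - v 0‖ + K * t := by
  choose! hdom v' hderiv_v hdefect using hv.defect_le
  set J := hA.resolvent hl
  set B := hA.yosida hl
  have hderiv : ∀ s ∈ Set.Ioo 0 T, HasDerivAt (fun s => J (y s - v s))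
      (B (y s) + J (g s) - J (v' s)) s := fun s hs => by
    simp only [map_sub]
    exact (hy.hasDerivAt_resolvent hA hg hl hs).sub
      (J.hasFDerivAt.comp_hasDerivAt s (hderiv_v s hs))
  have hinner : ∀ s ∈ Set.Ioo 0 T,
      ⟪J (y s - v s), B (y s) + J (g s) - J (v' s)⟫_ℝ ≤ K * ‖J (y s - v s)‖ := fun s hs => by
    have hsplit : B (y s) + J (g s) - J (v' s) =
        B (y s - v s) + J (A ⟨v s, hdom s hs⟩ + g s - v' s) := by
      rw [map_sub B, map_sub J, map_add, hA.resolvent_map]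
      abel
    calc ⟪J (y s - v s), B (y s) + J (g s) - J (v' s)⟫_ℝ
        = ⟪J (y s - v s), B (y s - v s)⟫_ℝ +
            ⟪J (y s - v s), J (A ⟨v s, hdom s hs⟩ + g s - v' s)⟫_ℝ := by
          rw [hsplit, inner_add_right]
      _ ≤ 0 + ‖J (y s - v s)‖ * ‖J (A ⟨v s, hdom s hs⟩ + g s - v' s)‖ :=
          add_le_add (hA.inner_resolvent_yosida_nonpos hl _) (real_inner_le_norm _ _)
      _ ≤ 0 + ‖J (y s - v s)‖ * K := by
          gcongr
          exact (hA.norm_resolvent_apply_le hl _).trans (hdefect s hs)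
      _ = K * ‖J (y s - v s)‖ := by ring
  have henergy := norm_le_add_mul_of_inner_deriv_le hK
    (J.continuous.comp_continuousOn (hy.continuousOn.sub hv.continuousOn)) hderiv hinner ht
  simp only [Function.comp_apply, Pi.sub_apply, sub_zero,
    hy.apply_zero (ht.1.trans ht.2)] at henergy
  exact henergy.trans (by gcongr; exact hA.norm_resolvent_apply_le hl _)

theorem IsSolution.norm_sub_le [CompleteSpace H] (hy : IsSolution A T x g y)
    (hA : IsMDissipative A) (hg : ContinuousOn g (Set.Icc 0 T))
    (hv : IsApproxSolution A T K g v) (hK : 0 ≤ K) {t : ℝ} (ht : t ∈ Set.Icc 0 T) :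
    ‖y t - v t‖ ≤ ‖x - v 0‖ + K * t :=
  le_of_tendsto (hA.tendsto_resolvent (y t - v t)).norm
    (Eventually.of_forall fun l => hy.norm_resolvent_sub_le hA hg hv hK l.2 ht)

end Stability

section Data

theorem toL2_of_memLp {α : Type*} [MeasurableSpace α] {ν : Measure α} {v : α → ℝ}
    (hv : MemLp v 2 ν) : toL2 ν v = hv.toLp v :=
  dif_pos hv

theorem IsCn.continuous {n : ℕ∞} {v : ℍ → ℝ} (hv : IsCn n v) : Continuous v :=
  (hv.continuousOn.comp_continuous UpperHalfPlane.continuous_coe im_pos).congr fun z =>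
    congrArg v (ofComplex_apply z)

theorem tensorNorm_iterCovDeriv_zero (v : ℍ → ℝ) (z : ℍ) :
    tensorNorm (iterCovDeriv v 0) z = |v z| := by
  simp [tensorNorm, iterCovDeriv, Real.sqrt_sq_eq_abs]

theorem eLpNorm_le_weightedNorm {w : ℝ} (hw : 0 ≤ w) (v : ℍ → ℝ) :
    eLpNorm v 2 volume ≤ weightedNorm w v := by
  have hweight : ∀ z : ℍ, ‖v z‖ ≤
      ‖Real.exp (w * dist UpperHalfPlane.I z) * tensorNorm (iterCovDeriv v 0) z‖ := fun z => by
    rw [tensorNorm_iterCovDeriv_zero, norm_mul, Real.norm_eq_abs, Real.norm_eq_abs,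
      Real.norm_eq_abs, abs_abs, Real.abs_exp]
    exact le_mul_of_one_le_left (abs_nonneg _) (Real.one_le_exp (mul_nonneg hw dist_nonneg))
  exact (eLpNorm_mono hweight).trans (Finset.single_le_sum (f := fun α => eLpNorm (fun z : ℍ =>
    Real.exp (w * dist UpperHalfPlane.I z) * tensorNorm (iterCovDeriv v α) z) 2 volume)
    (fun _ _ => zero_le) (Finset.mem_range.mpr (Nat.succ_pos 6)))

theorem MemM.memLp {v : ℍ → ℝ} (hv : MemM v) : MemLp v 2 volume :=
  ⟨hv.1.continuous.aestronglyMeasurable,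
    (eLpNorm_le_weightedNorm zero_le_one v).trans_lt (hv.2 1 one_pos)⟩

theorem AdmissibleData.continuousOn_toL2 {T : ℝ} {u₀ : ℍ → ℝ} {f : ℝ → ℍ → ℝ}
    (h : AdmissibleData T u₀ f) :
    ContinuousOn (fun t => toL2 volume (f t)) (Set.Icc 0 T) := by
  intro t ht
  rw [ContinuousWithinAt, tendsto_iff_edist_tendsto_0]
  refine tendsto_of_tendsto_of_tendsto_of_le_of_le' tendsto_const_nhds
    (h.source_continuous 1 one_pos t ht) (Eventually.of_forall fun _ => zero_le) ?_
  filter_upwards [self_mem_nhdsWithin] with s hs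
  rw [toL2_of_memLp (h.source s hs).memLp, toL2_of_memLp (h.source t ht).memLp,
    Lp.edist_toLp_toLp]
  exact eLpNorm_le_weightedNorm zero_le_one _

end Data

namespace Grid

variable {G : Grid}

theorem integrableOn_cell (v : HypL2) (p : G.Z₁ × G.Z₂) : IntegrableOn v (G.cell p) :=
  integrableOn_Lp_of_measure_ne_top v one_le_two (G.area_ne_top p)

theorem cellMean_add (v w : HypL2) : G.cellMean (v + w) = G.cellMean v + G.cellMean w := by
  ext p
  have hint : ∫ z in G.cell p, (v + w : HypL2) z =
      (∫ z in G.cell p, v z) + ∫ z in G.cell p, w z :=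
    (integral_congr_ae (ae_restrict_of_ae (Lp.coeFn_add v w))).trans
      (integral_add (integrableOn_cell v p) (integrableOn_cell w p))
  rw [Pi.add_apply, cellMean, hint, mul_add, cellMean, cellMean]

theorem cellMean_smul (c : ℝ) (v : HypL2) : G.cellMean (c • v) = c • G.cellMean v := by
  ext p
  have hint : ∫ z in G.cell p, (c • v : HypL2) z = c * ∫ z in G.cell p, v z :=
    (integral_congr_ae (ae_restrict_of_ae (Lp.coeFn_smul c v))).trans (integral_const_mul c _)
  rw [Pi.smul_apply, cellMean, hint, cellMean, smul_eq_mul, mul_left_comm]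

theorem ContractiveProj.proj_eq_toLp (hG : G.ContractiveProj) (v : HypL2) :
    G.proj v = (hG v).1.toLp (G.cellMean v) :=
  toL2_of_memLp (hG v).1

/-- The projection `Π_h` as a bounded linear operator; it is linear on all of `L²` because, under
(L1), `proj` never takes the default value of `toL2`. -/
def ContractiveProj.projCLM (hG : G.ContractiveProj) : HypL2 →L[ℝ] G.GridL2 :=
  LinearMap.mkContinuous
    { toFun := G.proj
      map_add' := fun v w => by
        rw [hG.proj_eq_toLp, hG.proj_eq_toLp v, hG.proj_eq_toLp w, ← MemLp.toLp_add]
        simp only [cellMean_add]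
      map_smul' := fun c v => by
        rw [hG.proj_eq_toLp, hG.proj_eq_toLp v, RingHom.id_apply, ← MemLp.toLp_const_smul]
        simp only [cellMean_smul] }
    1 fun v => (hG v).2.trans_eq (one_mul _).symm

theorem ContractiveProj.continuous_proj (hG : G.ContractiveProj) : Continuous G.proj :=
  hG.projCLM.continuous

theorem ContractiveProj.hasDerivAt_proj (hG : G.ContractiveProj) {u : ℝ → HypL2} {u' : HypL2}
    {t : ℝ} (hu : HasDerivAt u u' t) : HasDerivAt (fun s => G.proj (u s)) (G.proj u') t :=
  hG.projCLM.hasFDerivAt.comp_hasDerivAt t hu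

end Grid

section Convergence

variable {G : Grid} {L : G.GridL2 →ₗ.[ℝ] G.GridL2} {T K : ℝ} {u₀ : ℍ → ℝ} {f : ℝ → ℍ → ℝ}
  {u : ℝ → HypL2} {uh : ℝ → G.GridL2}

theorem IsHeatSolution.isApproxSolution_proj (hu : IsHeatSolution T u₀ f u)
    (hG : G.ContractiveProj)
    (hcons : ∀ t ∈ Set.Ioo 0 T, ∀ w, HasLaplacian (u t) w →
      ∃ hdom : G.proj (u t) ∈ L.domain, ‖L ⟨G.proj (u t), hdom⟩ - G.proj w‖ ≤ K) :
    IsApproxSolution L T K (fun t => G.proj (toL2 volume (f t))) fun t => G.proj (u t) where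
  continuousOn := hG.continuous_proj.comp_continuousOn hu.continuousOn
  defect_le t ht := by
    obtain ⟨w, hw, hderiv⟩ := hu.equation t (Set.Ioo_subset_Ioc_self ht)
    obtain ⟨hdom, hle⟩ := hcons t ht w hw
    refine ⟨hdom, G.proj (w + toL2 volume (f t)),
      hG.hasDerivAt_proj (hderiv.hasDerivAt (Icc_mem_nhds ht.1 ht.2)), ?_⟩
    have hadd : G.proj (w + toL2 volume (f t)) = G.proj w + G.proj (toL2 volume (f t)) :=
      map_add hG.projCLM _ _
    rwa [hadd, add_sub_add_right_eq_sub]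

theorem IsSemidiscreteSolution.norm_sub_proj_le (huh : IsSemidiscreteSolution G L T u₀ f uh)
    (hL : IsMDissipative L) (hG : G.ContractiveProj) (hdata : AdmissibleData T u₀ f)
    (hu : IsHeatSolution T u₀ f u) (hK : 0 ≤ K)
    (hcons : ∀ t ∈ Set.Ioo 0 T, ∀ w, HasLaplacian (u t) w →
      ∃ hdom : G.proj (u t) ∈ L.domain, ‖L ⟨G.proj (u t), hdom⟩ - G.proj w‖ ≤ K)
    {t : ℝ} (ht : t ∈ Set.Icc 0 T) :
    ‖uh t - G.proj (u t)‖ ≤ K * t := by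
  have hsource : ContinuousOn (fun t => G.proj (toL2 volume (f t))) (Set.Icc 0 T) :=
    hG.continuous_proj.comp_continuousOn hdata.continuousOn_toL2
  simpa only [hu.initial, sub_self, norm_zero, zero_add] using
    IsSolution.norm_sub_le huh hL hsource (hu.isApproxSolution_proj hG hcons) hK ht

end Convergence

end FDM

end

theorem mainTheorem2_general
    (G : ℝ → FDM.Grid)
    (L : (h : ℝ) → (G h).GridL2 →ₗ.[ℝ] (G h).GridL2)
    (h₀ : ℝ)
    (hL1 : ∀ h ∈ Set.Ioo 0 h₀, (G h).ContractiveProj)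
    (hL2 : ∀ h ∈ Set.Ioo 0 h₀, FDM.IsMDissipative (L h))
    (hL3 : FDM.Consistent G L h₀)
    (T : ℝ) (hT : 0 < T) (u₀ : ℍ → ℝ) (f : ℝ → ℍ → ℝ)
    (hdata : FDM.AdmissibleData T u₀ f) :
    ∃ C : ℝ, 0 < C ∧
      ∀ u : ℝ → FDM.HypL2, FDM.IsHeatSolution T u₀ f u →
      ∀ h ∈ Set.Ioo 0 h₀, ∀ uh : ℝ → (G h).GridL2,
        FDM.IsSemidiscreteSolution (G h) (L h) T u₀ f uh →
        ∀ t ∈ Set.Icc 0 T, ‖uh t - (G h).proj (u t)‖ ≤ C * h ^ 2 := by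
  obtain ⟨C, hC, hcons⟩ := hL3 T u₀ f hT hdata
  refine ⟨C * T, mul_pos hC hT, fun u hu h hh uh huh t ht => ?_⟩
  calc ‖uh t - (G h).proj (u t)‖ ≤ C * h ^ 2 * t :=
        huh.norm_sub_proj_le (hL2 h hh) (hL1 h hh) hdata hu (by positivity)
          (fun s hs => hcons u hu h hh s (Set.Ioo_subset_Icc_self hs)) ht
    _ ≤ C * h ^ 2 * T := by gcongr; exact ht.2
    _ = C * T * h ^ 2 := by ring

theorem mainTheorem2
    (G : ℝ → FDM.Grid)
    (L : (h : ℝ) → (G h).GridL2 →ₗ.[ℝ] (G h).GridL2)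
    (h₀ : ℝ) (hh₀ : 0 < h₀)
    (hL1 : ∀ h ∈ Set.Ioo 0 h₀, (G h).ContractiveProj)
    (hL2 : ∀ h ∈ Set.Ioo 0 h₀, IsSelfAdjoint (L h) ∧ FDM.IsMDissipative (L h))
    (hL3 : FDM.Consistent G L h₀)
    (T : ℝ) (hT : 0 < T) (u₀ : ℍ → ℝ) (f : ℝ → ℍ → ℝ)
    (hdata : FDM.AdmissibleData T u₀ f) :
    ∃ C : ℝ, 0 < C ∧
      ∀ u : ℝ → FDM.HypL2, FDM.IsHeatSolution T u₀ f u →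
      ∀ h ∈ Set.Ioo 0 h₀, ∀ uh : ℝ → (G h).GridL2,
        FDM.IsSemidiscreteSolution (G h) (L h) T u₀ f uh →
        ∀ t ∈ Set.Icc 0 T, ‖uh t - (G h).proj (u t)‖ ≤ C * h ^ 2 :=
  mainTheorem2_general G L h₀ hL1 (fun h hh => (hL2 h hh).2) hL3 T hT u₀ f hdata
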